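/- Let $\alpha,\beta>-1$ and let $M,N$ be nonzero real numbers. Let $d\mu(x)=(1-x)^{\alpha}(1+x)^{\beta}\,dx$ on $[-1,1]$ and, for real polynomials $p,q$, put $$\langle p,q\rangle_S=\int_{-1}^{1}p(x)q(x)\,d\mu(x)+M\,p(-1)q(-1)+N\,p'(-1)q'(-1)$$ (an inner product when $M,N>0$). Let $P_n^{(\alpha,\beta)}$ be the monic Jacobi polynomial of degree $n$, i.e. the monic polynomial of degree $n$ orthogonal in $L^2(\mu)$ to all polynomials of degree less than $n$. Put $$c_n=\frac{(n+\alpha+\beta+1)_n}{2^n(\alpha+1)_n},\qquad \tilde P_n^{(\alpha,\beta)}=c_n\,P_n^{(\alpha,\beta)},$$ where $(x)_n=x(x+1)\cdots(x+n-1)$. Then for all sufficiently large $n$ there is exactly one monic polynomial of degree $n$ that is orthogonal with respect to $\langle\cdot,\cdot\rangle_S$ to all polynomials of degree less than $n$; let $Q_n^{M,N}$ be $c_n$ times this polynomial (so $Q_n^{M,N}$ has the same leading coefficient as $\tilde P_n^{(\alpha,\beta)}$). For every integer $j\ge 0$, $(\tilde P_n^{(\alpha,\beta)})^{(j)}(-1)\neq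 0$ for all sufficiently large $n$, and $$\lim_{n\to\infty}\frac{(Q_n^{M,N})^{(j)}(-1)}{(\tilde P_n^{(\alpha,\beta)})^{(j)}(-1)}=\frac{j(j-1)}{(\beta+j+1)(\beta+j+2)}.$$ In particular the limit does not depend on $M$ and $N$. -/

import Mathlib

open Polynomial Filter Topology

/-- `q` is monic of degree `n` and orthogonal, with respect to the form `B`, to every polynomial
of degree less than `n`. -/
def IsMonicOrthogonal (B : ℝ[X] → ℝ[X] → ℝ) (n : ℕ) (q : ℝ[X]) : Prop :=
  q.Monic ∧ q.natDegree = n ∧ ∀ p : ℝ[X], p.degree < (n : WithBot ℕ) → B q p = 0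

open Classical in
/-- The monic orthogonal polynomial of degree `n` for the form `B`
(with the convention `0` if there is not exactly one). -/
noncomputable def monicOrthogonal (B : ℝ[X] → ℝ[X] → ℝ) (n : ℕ) : ℝ[X] :=
  if h : ∃! q : ℝ[X], IsMonicOrthogonal B n q then h.choose else 0

/-- `⟨p, q⟩_μ = ∫ p q dμ` for the Jacobi measure `dμ = (1 - x)^α (1 + x)^β dx` on `[-1, 1]`. -/
noncomputable def jacobiForm (α β : ℝ) (p q : ℝ[X]) : ℝ :=
  ∫ x in (-1 : ℝ)..1, p.eval x * q.eval x * ((1 - x) ^ α * (1 + x) ^ β)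

/-- `⟨p, q⟩_S = ∫ p q dμ + M p(a) q(a) + N p'(a) q'(a)` with `μ` the Jacobi measure. -/
noncomputable def sobolevForm (α β a M N : ℝ) (p q : ℝ[X]) : ℝ :=
  jacobiForm α β p q + M * p.eval a * q.eval a
    + N * (derivative p).eval a * (derivative q).eval a

/-- The scaling factor `(n + α + β + 1)_n / (2^n (α + 1)_n)`, where `(x)_n = x (x+1) ⋯ (x+n-1)`. -/
noncomputable def jacobiScale (α β : ℝ) (n : ℕ) : ℝ :=
  (ascPochhammer ℝ n).eval ((n : ℝ) + α + β + 1) / (2 ^ n * (ascPochhammer ℝ n).eval (α + 1))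

/-- The scaled Jacobi polynomial: the scaling factor times the monic Jacobi polynomial. -/
noncomputable def scaledJacobi (α β : ℝ) (n : ℕ) : ℝ[X] :=
  C (jacobiScale α β n) * monicOrthogonal (jacobiForm α β) n

/-- The Sobolev-type orthogonal polynomial of degree `n` for the point `a = -1`, normalized to
have the same leading coefficient as the scaled Jacobi polynomial. -/
noncomputable def scaledSobolevJacobi (α β M N : ℝ) (n : ℕ) : ℝ[X] :=
  C (jacobiScale α β n) * monicOrthogonal (sobolevForm α β (-1) M N) n

/-!
Write `Pₙ` for the monic Jacobi polynomials and allow, more generally, a mass at each of finitely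
many functionals `φᵢ(p) = p^(dᵢ)(-1)`. The orthogonal polynomial of the perturbed form differs from
`Pₙ` by a combination of the polynomials that reproduce the `φᵢ` on degrees below `n`, so its
coefficients solve a linear system built from the kernels `∑_{m<n} φᵢ(Pₘ) φⱼ(Pₘ) / ‖Pₘ‖²`. The
general term of such a kernel grows like `n ^ (2β + 1 + 2dᵢ + 2dⱼ)`, as the differential equation at
`-1` and the three-term recurrence show; by Stolz–Cesàro the kernel divided by `n` times that term
tends to `1 / (2 (β + 1 + dᵢ + dⱼ))`, while the masses enter only through a diagonal that vanishes
in the limit. What remains is a Cauchy system, which is solved by the partial fraction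
decomposition of `1 - ∏ᵢ (x - dᵢ) / (x + β + 1 + dᵢ)`; evaluating at `x = j` gives the limit
`∏ᵢ (j - dᵢ) / (β + 1 + j + dᵢ)`, whatever the masses.
-/

theorem degree_sub_lt_of_monic {R : Type*} [Ring R] [Nontrivial R] {p q : R[X]} {n : ℕ}
    (hp : p.Monic) (hq : q.Monic) (hpn : p.natDegree = n) (hqn : q.natDegree = n) :
    (p - q).degree < n := by
  have hpd : p.degree = n := by rw [degree_eq_natDegree hp.ne_zero, hpn]
  have hqd : q.degree = n := by rw [degree_eq_natDegree hq.ne_zero, hqn]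
  rw [← hpd]
  exact degree_sub_lt_left (hpd.trans hqd.symm) hp.ne_zero (by rw [hp, hq])

namespace IsMonicOrthogonal

variable {B B' : ℝ[X] → ℝ[X] → ℝ} {n : ℕ} {p q : ℝ[X]}

theorem degree_eq (hq : IsMonicOrthogonal B n q) : q.degree = n := by
  rw [degree_eq_natDegree hq.1.ne_zero, hq.2.1]

theorem coeff_self (hq : IsMonicOrthogonal B n q) : q.coeff n = 1 := by
  rw [← hq.2.1, hq.1.coeff_natDegree]

theorem degree_sub_lt (hp : IsMonicOrthogonal B n p) (hq : IsMonicOrthogonal B' n q) :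
    (p - q).degree < n :=
  degree_sub_lt_of_monic hp.1 hq.1 hp.2.1 hq.2.1

theorem degree_sub_C_coeff_mul_lt (hq : IsMonicOrthogonal B n q) (hp : p.natDegree ≤ n) :
    (p - C (p.coeff n) * q).degree < n := by
  rw [degree_lt_iff_coeff_zero]
  intro m hm
  rw [coeff_sub, coeff_C_mul]
  rcases hm.eq_or_lt with rfl | hm
  · rw [hq.coeff_self, mul_one, sub_self]
  · rw [coeff_eq_zero_of_natDegree_lt (hp.trans_lt hm),
      coeff_eq_zero_of_natDegree_lt (hq.2.1.trans_lt hm), mul_zero, sub_zero]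

theorem apply_eq_coeff_mul {B : LinearMap.BilinForm ℝ ℝ[X]}
    (hq : IsMonicOrthogonal (fun p q => B p q) n q) (hp : p.natDegree ≤ n) :
    B q p = p.coeff n * B q q := by
  have h : B q (p - C (p.coeff n) * q) = 0 := hq.2.2 _ (hq.degree_sub_C_coeff_mul_lt hp)
  rwa [map_sub, ← smul_eq_C_mul, map_smul, smul_eq_mul, sub_eq_zero] at h

end IsMonicOrthogonal

theorem isMonicOrthogonal_monicOrthogonal {B : ℝ[X] → ℝ[X] → ℝ} {n : ℕ}
    (h : ∃! q, IsMonicOrthogonal B n q) : IsMonicOrthogonal B n (monicOrthogonal B n) := by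
  rw [monicOrthogonal, dif_pos h]
  exact h.choose_spec.1

theorem existsUnique_isMonicOrthogonal {B : LinearMap.BilinForm ℝ ℝ[X]}
    (hB : ∀ p, B p p = 0 → p = 0) (n : ℕ) : ∃! q, IsMonicOrthogonal (fun p q => B p q) n q := by
  have : FiniteDimensional ℝ (degreeLT ℝ n) := (degreeLTEquiv ℝ n).symm.finiteDimensional
  have hinj : Function.Injective (B.restrict (degreeLT ℝ n)) := by
    rw [injective_iff_map_eq_zero]
    exact fun p hp => Subtype.ext (hB p (LinearMap.congr_fun hp p))
  obtain ⟨⟨r, hr_mem⟩, hr⟩ := (LinearMap.injective_iff_surjective_of_finrank_eq_finrank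
    Subspace.dual_finrank_eq.symm).1 hinj ((B (X ^ n)).domRestrict (degreeLT ℝ n))
  have hr_deg : r.degree < n := mem_degreeLT.1 hr_mem
  have hq : IsMonicOrthogonal (fun p q => B p q) n (X ^ n - r) := by
    refine ⟨monic_X_pow_sub hr_deg, natDegree_eq_of_degree_eq_some ?_, fun p hp => ?_⟩
    · rw [degree_sub_eq_left_of_degree_lt (by rwa [degree_X_pow]), degree_X_pow]
    · have hrp : B r p = B (X ^ n) p := LinearMap.congr_fun hr ⟨p, mem_degreeLT.2 hp⟩
      simp only [map_sub, LinearMap.sub_apply, hrp, sub_self]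
  refine ⟨_, hq, fun q' hq' => sub_eq_zero.1 (hB _ ?_)⟩
  have hdeg := hq'.degree_sub_lt hq
  have h₁ : B q' (q' - (X ^ n - r)) = 0 := hq'.2.2 _ hdeg
  have h₂ : B (X ^ n - r) (q' - (X ^ n - r)) = 0 := hq.2.2 _ hdeg
  rw [LinearMap.map_sub₂, h₁, h₂, sub_zero]

/-- `P` is a sequence of monic orthogonal polynomials for the symmetric bilinear form `B`, none of
them isotropic. The form itself need not be positive definite. -/
structure IsMonicOrthogonalBasis (B : LinearMap.BilinForm ℝ ℝ[X]) (P : ℕ → ℝ[X]) : Prop where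
  isSymm : B.IsSymm
  isMonicOrthogonal : ∀ n, IsMonicOrthogonal (fun p q => B p q) n (P n)
  apply_self_ne_zero : ∀ n, B (P n) (P n) ≠ 0

/-- The `m`-th term `φ(Pₘ) ψ(Pₘ) / ⟨Pₘ, Pₘ⟩` of the reproducing kernel of the polynomials `P`,
evaluated at a pair of linear functionals. -/
noncomputable def kernelTerm (B : LinearMap.BilinForm ℝ ℝ[X]) (P : ℕ → ℝ[X])
    (φ ψ : ℝ[X] →ₗ[ℝ] ℝ) (m : ℕ) : ℝ :=
  φ (P m) * ψ (P m) / B (P m) (P m)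

/-- The kernel `∑ m < n, φ(Pₘ) ψ(Pₘ) / ⟨Pₘ, Pₘ⟩` divided by `n` times its first omitted term. -/
noncomputable def normalizedKernel (B : LinearMap.BilinForm ℝ ℝ[X]) (P : ℕ → ℝ[X])
    (φ ψ : ℝ[X] →ₗ[ℝ] ℝ) (n : ℕ) : ℝ :=
  (∑ m ∈ Finset.range n, kernelTerm B P φ ψ m) / (n * kernelTerm B P φ ψ n)

/-- The polynomial of degree less than `n` that represents the functional `φ` on the polynomials of
degree less than `n`. -/
noncomputable def reproducingPolynomial (B : LinearMap.BilinForm ℝ ℝ[X]) (P : ℕ → ℝ[X])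
    (φ : ℝ[X] →ₗ[ℝ] ℝ) (n : ℕ) : ℝ[X] :=
  ∑ m ∈ Finset.range n, (φ (P m) / B (P m) (P m)) • P m

theorem map_reproducingPolynomial (B : LinearMap.BilinForm ℝ ℝ[X]) (P : ℕ → ℝ[X])
    (φ ψ : ℝ[X] →ₗ[ℝ] ℝ) (n : ℕ) :
    ψ (reproducingPolynomial B P φ n) = ∑ m ∈ Finset.range n, kernelTerm B P φ ψ m := by
  simp only [reproducingPolynomial, kernelTerm, map_sum, map_smul, smul_eq_mul, div_mul_eq_mul_div]

namespace IsMonicOrthogonalBasis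

variable {B : LinearMap.BilinForm ℝ ℝ[X]} {P : ℕ → ℝ[X]} {p : ℝ[X]} {m n : ℕ}

theorem of_anisotropic (hsymm : B.IsSymm) (hB : ∀ p, B p p = 0 → p = 0)
    (hP : ∀ n, IsMonicOrthogonal (fun p q => B p q) n (P n)) : IsMonicOrthogonalBasis B P :=
  ⟨hsymm, hP, fun n h => (hP n).1.ne_zero (hB _ h)⟩

theorem degree_lt (hP : IsMonicOrthogonalBasis B P) (hmn : m < n) : (P m).degree < n := by
  rw [(hP.isMonicOrthogonal m).degree_eq]
  exact_mod_cast hmn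

theorem apply_eq_zero (hP : IsMonicOrthogonalBasis B P) (hp : p.degree < n) : B (P n) p = 0 :=
  (hP.isMonicOrthogonal n).2.2 p hp

theorem apply_of_ne (hP : IsMonicOrthogonalBasis B P) (hmn : m ≠ n) : B (P m) (P n) = 0 := by
  rcases lt_or_gt_of_ne hmn with h | h
  · rw [hP.isSymm.eq]
    exact hP.apply_eq_zero (hP.degree_lt h)
  · exact hP.apply_eq_zero (hP.degree_lt h)

theorem eq_zero_of_forall_apply_eq_zero (hP : IsMonicOrthogonalBasis B P) (hp : p.degree < n)
    (h : ∀ m < n, B (P m) p = 0) : p = 0 := by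
  by_contra hp0
  have happly := (hP.isMonicOrthogonal p.natDegree).apply_eq_coeff_mul le_rfl
  rw [h _ ((natDegree_lt_iff_degree_lt hp0).2 hp)] at happly
  exact mul_ne_zero (leadingCoeff_ne_zero.2 hp0) (hP.apply_self_ne_zero _) happly.symm

theorem degree_sum_smul_lt (hP : IsMonicOrthogonalBasis B P) (a : ℕ → ℝ) (n : ℕ) :
    (∑ m ∈ Finset.range n, a m • P m).degree < n :=
  mem_degreeLT.1 <| Submodule.sum_mem _ fun _ hm =>
    Submodule.smul_mem _ _ (mem_degreeLT.2 (hP.degree_lt (Finset.mem_range.1 hm)))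

theorem apply_sum_smul (hP : IsMonicOrthogonalBasis B P) (a : ℕ → ℝ) (hmn : m < n) :
    B (P m) (∑ k ∈ Finset.range n, a k • P k) = a m * B (P m) (P m) := by
  rw [map_sum, Finset.sum_eq_single_of_mem m (Finset.mem_range.2 hmn), map_smul, smul_eq_mul]
  intro k _ hkm
  rw [map_smul, hP.apply_of_ne hkm.symm, smul_zero]

theorem eq_sum_smul (hP : IsMonicOrthogonalBasis B P) (hp : p.degree < n) :
    p = ∑ m ∈ Finset.range n, (B (P m) p / B (P m) (P m)) • P m := by
  refine sub_eq_zero.1 (hP.eq_zero_of_forall_apply_eq_zero (n := n)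
    ((degree_sub_le _ _).trans_lt (max_lt hp (hP.degree_sum_smul_lt _ n))) fun m hm => ?_)
  rw [map_sub, hP.apply_sum_smul _ hm, div_mul_cancel₀ _ (hP.apply_self_ne_zero m), sub_self]

theorem map_eq_C_coeff_mul (hP : IsMonicOrthogonalBasis B P) {L : ℝ[X] → ℝ[X]}
    (hL : ∀ p q, B (L p) q = B p (L q)) (hdeg : ∀ p, (L p).natDegree ≤ p.natDegree) (n : ℕ) :
    L (P n) = C ((L (P n)).coeff n) * P n := by
  have hn := hP.isMonicOrthogonal n
  refine sub_eq_zero.1 (hP.eq_zero_of_forall_apply_eq_zero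
    (hn.degree_sub_C_coeff_mul_lt ((hdeg _).trans hn.2.1.le)) fun m hm => ?_)
  have hLm : (L (P m)).degree < n := degree_le_natDegree.trans_lt (by
    exact_mod_cast (hdeg (P m)).trans_lt ((hP.isMonicOrthogonal m).2.1.trans_lt hm))
  rw [map_sub, ← smul_eq_C_mul, map_smul, hP.apply_of_ne hm.ne, smul_zero, sub_zero, ← hL,
    hP.isSymm.eq, hP.apply_eq_zero hLm]

theorem degree_reproducingPolynomial_lt (hP : IsMonicOrthogonalBasis B P) (φ : ℝ[X] →ₗ[ℝ] ℝ)
    (n : ℕ) : (reproducingPolynomial B P φ n).degree < n :=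
  hP.degree_sum_smul_lt _ n

theorem reproducingPolynomial_apply (hP : IsMonicOrthogonalBasis B P) (φ : ℝ[X] →ₗ[ℝ] ℝ)
    (hp : p.degree < n) : B (reproducingPolynomial B P φ n) p = φ p := by
  conv_rhs => rw [hP.eq_sum_smul hp]
  simp only [reproducingPolynomial, map_sum, LinearMap.sum_apply, map_smul, LinearMap.smul_apply,
    smul_eq_mul]
  exact Finset.sum_congr rfl fun m _ => by ring

theorem exists_three_term_recurrence (hP : IsMonicOrthogonalBasis B P) (a : ℝ)
    (hmul : ∀ p q, B ((X - C a) * p) q = B p ((X - C a) * q)) (n : ℕ) :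
    ∃ b : ℝ, (X - C a) * P (n + 1) = P (n + 2) + b • P (n + 1) +
      (B (P (n + 1)) (P (n + 1)) / B (P n) (P n)) • P n := by
  have hmonic (m : ℕ) : ((X - C a) * P m).Monic :=
    (monic_X_sub_C a).mul (hP.isMonicOrthogonal m).1
  have hnat (m : ℕ) : ((X - C a) * P m).natDegree = m + 1 := by
    rw [(monic_X_sub_C a).natDegree_mul (hP.isMonicOrthogonal m).1, natDegree_X_sub_C,
      (hP.isMonicOrthogonal m).2.1, add_comm]
  have hlow : ∀ m < n, B (P (n + 1)) ((X - C a) * P m) = 0 := fun m hm =>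
    hP.apply_eq_zero (degree_le_natDegree.trans_lt
      (by rw [hnat]; exact_mod_cast Nat.succ_lt_succ hm))
  have htop : B (P (n + 1)) ((X - C a) * P n) = B (P (n + 1)) (P (n + 1)) := by
    rw [(hP.isMonicOrthogonal (n + 1)).apply_eq_coeff_mul (hnat n).le, ← hnat n,
      (hmonic n).coeff_natDegree, one_mul, hnat n]
  have hrem (m : ℕ) (hm : m < n + 1) : B (P m) ((X - C a) * P (n + 1) - P (n + 2)) =
      B (P (n + 1)) ((X - C a) * P m) := by
    rw [map_sub, hP.apply_of_ne (by omega), sub_zero, ← hmul, hP.isSymm.eq]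
  have hdeg : ((X - C a) * P (n + 1) - P (n + 2)).degree < ((n + 2 : ℕ) : WithBot ℕ) :=
    degree_sub_lt_of_monic (hmonic _) (hP.isMonicOrthogonal _).1 (hnat _)
      (hP.isMonicOrthogonal _).2.1
  have hexp := hP.eq_sum_smul hdeg
  rw [Finset.sum_range_succ, Finset.sum_range_succ, hrem n n.lt_succ_self, htop,
    Finset.sum_eq_zero, zero_add, sub_eq_iff_eq_add'] at hexp
  · exact ⟨_, hexp.trans (by rw [add_comm ((_ / _) • P n), ← add_assoc])⟩
  · intro m hm
    have hm' := Finset.mem_range.1 hm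
    rw [hrem m (by omega), hlow m hm', zero_div, zero_smul]

end IsMonicOrthogonalBasis

section Perturbation

variable {ι : Type*}

/-- The matrix of the linear system for the coefficients of the polynomials that correct `Pₙ`, see
`correctedPolynomial`. -/
noncomputable def perturbationMatrix [DecidableEq ι] (B : LinearMap.BilinForm ℝ ℝ[X])
    (P : ℕ → ℝ[X]) (c : ι → ℝ) (φ : ι → ℝ[X] →ₗ[ℝ] ℝ) (n : ℕ) : Matrix ι ι ℝ :=
  Matrix.diagonal (fun i => (c i * (n * kernelTerm B P (φ i) (φ i) n))⁻¹) +
    Matrix.of fun i j => normalizedKernel B P (φ j) (φ i) n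

theorem tendsto_perturbationMatrix [DecidableEq ι] {B : LinearMap.BilinForm ℝ ℝ[X]}
    {P : ℕ → ℝ[X]} {φ : ι → ℝ[X] →ₗ[ℝ] ℝ} {κ : Matrix ι ι ℝ} (c : ι → ℝ)
    (hterm : ∀ i, Tendsto (fun n : ℕ => (n * kernelTerm B P (φ i) (φ i) n)⁻¹) atTop (𝓝 0))
    (hκ : ∀ i j, Tendsto (normalizedKernel B P (φ j) (φ i)) atTop (𝓝 (κ i j))) :
    Tendsto (perturbationMatrix B P c φ) atTop (𝓝 κ) := by
  refine tendsto_pi_nhds.2 fun i => tendsto_pi_nhds.2 fun j => ?_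
  have hdiag : Tendsto (fun n : ℕ => Matrix.diagonal
      (fun i => (c i * (n * kernelTerm B P (φ i) (φ i) n))⁻¹) i j) atTop (𝓝 0) := by
    rcases eq_or_ne i j with rfl | hij
    · simpa only [Matrix.diagonal_apply_eq, mul_inv, mul_zero] using
        (hterm i).const_mul (c i)⁻¹
    · simp only [Matrix.diagonal_apply_ne _ hij, tendsto_const_nhds]
  have h := hdiag.add (hκ i j)
  rw [zero_add] at h
  exact h

variable [Fintype ι]

/-- The form `B` perturbed by the masses `c i` at the linear functionals `φ i`. -/
noncomputable def perturbedForm (B : LinearMap.BilinForm ℝ ℝ[X]) (c : ι → ℝ) (φ : ι → ℝ[X] →ₗ[ℝ] ℝ)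
    (p q : ℝ[X]) : ℝ :=
  B p q + ∑ i, c i * φ i p * φ i q

/-- `Pₙ` corrected by multiples of the polynomials that reproduce the `φ i`. The coefficients are
scaled so that `v` solves a linear system whose matrix converges as `n → ∞`. -/
noncomputable def correctedPolynomial (B : LinearMap.BilinForm ℝ ℝ[X]) (P : ℕ → ℝ[X])
    (φ : ι → ℝ[X] →ₗ[ℝ] ℝ) (n : ℕ) (v : ι → ℝ) : ℝ[X] :=
  P n - ∑ i, (v i * B (P n) (P n) / (n * φ i (P n))) • reproducingPolynomial B P (φ i) n

namespace IsMonicOrthogonalBasis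

variable {B : LinearMap.BilinForm ℝ ℝ[X]} {P : ℕ → ℝ[X]} {c : ι → ℝ}
  {φ : ι → ℝ[X] →ₗ[ℝ] ℝ} {ψ : ℝ[X] →ₗ[ℝ] ℝ} {n : ℕ} {p q : ℝ[X]}

theorem degree_sum_smul_reproducingPolynomial_lt (hP : IsMonicOrthogonalBasis B P) (y : ι → ℝ)
    (n : ℕ) : (∑ i, y i • reproducingPolynomial B P (φ i) n).degree < n :=
  mem_degreeLT.1 <| Submodule.sum_mem _ fun _ _ =>
    Submodule.smul_mem _ _ (mem_degreeLT.2 (hP.degree_reproducingPolynomial_lt _ n))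

theorem sum_smul_reproducingPolynomial_apply (hP : IsMonicOrthogonalBasis B P) (y : ι → ℝ)
    (hp : p.degree < n) :
    B (∑ i, y i • reproducingPolynomial B P (φ i) n) p = ∑ i, y i * φ i p := by
  simp only [map_sum, LinearMap.sum_apply, map_smul, LinearMap.smul_apply, smul_eq_mul,
    hP.reproducingPolynomial_apply _ hp]

theorem isMonicOrthogonal_perturbedForm_iff (hP : IsMonicOrthogonalBasis B P) :
    IsMonicOrthogonal (perturbedForm B c φ) n q ↔
      q = P n - ∑ i, (c i * φ i q) • reproducingPolynomial B P (φ i) n := by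
  have hS := hP.degree_sum_smul_reproducingPolynomial_lt (φ := φ) (fun i => c i * φ i q) n
  constructor
  · intro hq
    have hdeg : (q - P n + ∑ i, (c i * φ i q) • reproducingPolynomial B P (φ i) n).degree < n :=
      (degree_add_le _ _).trans_lt
        (max_lt (hq.degree_sub_lt (hP.isMonicOrthogonal n)) hS)
    have hzero := hP.eq_zero_of_forall_apply_eq_zero hdeg fun m hm => by
      have hm' := hP.degree_lt hm
      have hqm : B q (P m) + ∑ i, c i * φ i q * φ i (P m) = 0 := hq.2.2 _ hm'
      rw [hP.isSymm.eq, map_add, LinearMap.add_apply, LinearMap.map_sub₂,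
        hP.apply_eq_zero hm', hP.sum_smul_reproducingPolynomial_apply _ hm', sub_zero, hqm]
    rw [eq_sub_iff_add_eq, ← sub_eq_zero, ← hzero]
    abel
  · intro hq
    have hS' := hS.trans_eq (hP.isMonicOrthogonal n).degree_eq.symm
    refine ⟨?_, ?_, fun p hp => ?_⟩
    · rw [hq]
      exact (hP.isMonicOrthogonal n).1.sub_of_left hS'
    · rw [hq, natDegree_eq_of_degree_eq (degree_sub_eq_left_of_degree_lt hS'),
        (hP.isMonicOrthogonal n).2.1]
    · have hBq : B q p = -∑ i, c i * φ i q * φ i p := by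
        conv_lhs => rw [hq]
        rw [LinearMap.map_sub₂, hP.apply_eq_zero hp,
          hP.sum_smul_reproducingPolynomial_apply _ hp, zero_sub]
      rw [perturbedForm, hBq, neg_add_cancel]

theorem map_correctedPolynomial (hP : IsMonicOrthogonalBasis B P) (hn : n ≠ 0)
    (hψ : ψ (P n) ≠ 0) (hφ : ∀ i, φ i (P n) ≠ 0) (v : ι → ℝ) :
    ψ (correctedPolynomial B P φ n v) =
      ψ (P n) * (1 - ∑ i, normalizedKernel B P (φ i) ψ n * v i) := by
  rw [correctedPolynomial, map_sub, map_sum, mul_sub, mul_one, Finset.mul_sum]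
  congr 1
  refine Finset.sum_congr rfl fun i _ => ?_
  rw [map_smul, map_reproducingPolynomial, smul_eq_mul, normalizedKernel,
    kernelTerm.eq_def _ _ _ _ n]
  have := hφ i
  have := hP.apply_self_ne_zero n
  field_simp

variable [DecidableEq ι]

theorem isMonicOrthogonal_perturbedForm_iff_exists (hP : IsMonicOrthogonalBasis B P)
    (hn : n ≠ 0) (hc : ∀ i, c i ≠ 0) (hφ : ∀ i, φ i (P n) ≠ 0) :
    IsMonicOrthogonal (perturbedForm B c φ) n q ↔
      ∃ v, (perturbationMatrix B P c φ n).mulVec v = 1 ∧ q = correctedPolynomial B P φ n v := by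
  have hB := hP.apply_self_ne_zero n
  have hcoeff (v : ι → ℝ) (hq : q = correctedPolynomial B P φ n v) (i : ι) :
      c i * φ i q = v i * B (P n) (P n) / (n * φ i (P n)) ↔
        (perturbationMatrix B P c φ n).mulVec v i = 1 := by
    rw [hq, hP.map_correctedPolynomial hn (hφ i) hφ, perturbationMatrix, Matrix.add_mulVec,
      Pi.add_apply, Matrix.mulVec_diagonal, ← eq_sub_iff_add_eq, kernelTerm]
    simp only [Matrix.mulVec, dotProduct, Matrix.of_apply]
    generalize 1 - ∑ j, normalizedKernel B P (φ j) (φ i) n * v j = s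
    have := hc i
    have := hφ i
    field_simp
    exact eq_comm
  rw [hP.isMonicOrthogonal_perturbedForm_iff]
  constructor
  · intro hq
    set v : ι → ℝ := fun i => c i * φ i q * (n * φ i (P n)) / B (P n) (P n) with hv
    have hvi (i : ι) : c i * φ i q = v i * B (P n) (P n) / (n * φ i (P n)) := by
      have := hφ i
      rw [hv]
      field_simp
    have hqv : q = correctedPolynomial B P φ n v := by
      simp only [correctedPolynomial, ← hvi]
      exact hq
    exact ⟨v, funext fun i => (hcoeff v hqv i).1 (hvi i), hqv⟩
  · rintro ⟨v, hv, hq⟩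
    simp only [fun i => (hcoeff v hq i).2 (congr_fun hv i)]
    exact hq

theorem isMonicOrthogonal_perturbedForm_iff_eq_correctedPolynomial
    (hP : IsMonicOrthogonalBasis B P) (hn : n ≠ 0) (hc : ∀ i, c i ≠ 0) (hφ : ∀ i, φ i (P n) ≠ 0)
    (hdet : (perturbationMatrix B P c φ n).det ≠ 0) :
    IsMonicOrthogonal (perturbedForm B c φ) n q ↔
      q = correctedPolynomial B P φ n ((perturbationMatrix B P c φ n)⁻¹.mulVec 1) := by
  have hunit := hdet.isUnit
  rw [hP.isMonicOrthogonal_perturbedForm_iff_exists hn hc hφ]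
  constructor
  · rintro ⟨v, hv, rfl⟩
    rw [← hv, Matrix.mulVec_mulVec, Matrix.nonsing_inv_mul _ hunit, Matrix.one_mulVec]
  · intro hq
    exact ⟨_, by rw [Matrix.mulVec_mulVec, Matrix.mul_nonsing_inv _ hunit, Matrix.one_mulVec], hq⟩

section Limit

variable {κ : Matrix ι ι ℝ} {l : ι → ℝ}

theorem eventually_isMonicOrthogonal_perturbedForm_iff (hP : IsMonicOrthogonalBasis B P)
    (hc : ∀ i, c i ≠ 0) (hφ : ∀ i, ∀ᶠ n in atTop, φ i (P n) ≠ 0)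
    (hterm : ∀ i, Tendsto (fun n : ℕ => (n * kernelTerm B P (φ i) (φ i) n)⁻¹) atTop (𝓝 0))
    (hκ : ∀ i j, Tendsto (normalizedKernel B P (φ j) (φ i)) atTop (𝓝 (κ i j)))
    (hdet : κ.det ≠ 0) :
    ∀ᶠ n in atTop, ∀ q, IsMonicOrthogonal (perturbedForm B c φ) n q ↔
      q = correctedPolynomial B P φ n ((perturbationMatrix B P c φ n)⁻¹.mulVec 1) := by
  have hdet' : Tendsto (fun n => (perturbationMatrix B P c φ n).det) atTop (𝓝 κ.det) :=
    (continuous_id.matrix_det.tendsto κ).comp (tendsto_perturbationMatrix c hterm hκ)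
  filter_upwards [eventually_ne_atTop 0, eventually_all.2 hφ, hdet'.eventually_ne hdet]
    with n hn hφn hdetn q
  exact hP.isMonicOrthogonal_perturbedForm_iff_eq_correctedPolynomial hn hc hφn hdetn

theorem tendsto_map_div_map (hP : IsMonicOrthogonalBasis B P)
    (hc : ∀ i, c i ≠ 0) (hφ : ∀ i, ∀ᶠ n in atTop, φ i (P n) ≠ 0)
    (hψ : ∀ᶠ n in atTop, ψ (P n) ≠ 0)
    (hterm : ∀ i, Tendsto (fun n : ℕ => (n * kernelTerm B P (φ i) (φ i) n)⁻¹) atTop (𝓝 0))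
    (hκ : ∀ i j, Tendsto (normalizedKernel B P (φ j) (φ i)) atTop (𝓝 (κ i j)))
    (hl : ∀ i, Tendsto (normalizedKernel B P (φ i) ψ) atTop (𝓝 (l i)))
    (hdet : κ.det ≠ 0) {v : ι → ℝ} (hv : κ.mulVec v = 1) {Q : ℕ → ℝ[X]}
    (hQ : ∀ᶠ n in atTop, IsMonicOrthogonal (perturbedForm B c φ) n (Q n)) :
    Tendsto (fun n => ψ (Q n) / ψ (P n)) atTop (𝓝 (1 - ∑ i, l i * v i)) := by
  have hinv : Tendsto (fun n => (perturbationMatrix B P c φ n)⁻¹.mulVec 1) atTop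
      (𝓝 v) := by
    rw [← Matrix.one_mulVec v, ← Matrix.nonsing_inv_mul _ hdet.isUnit, ← Matrix.mulVec_mulVec, hv]
    have hcont : ContinuousAt Inv.inv κ := continuousAt_matrix_inv κ (by
      rw [Ring.inverse_eq_inv']; exact continuousAt_inv₀ hdet)
    exact ((Continuous.matrix_mulVec continuous_id continuous_const).tendsto κ⁻¹).comp
      (hcont.tendsto.comp (tendsto_perturbationMatrix c hterm hκ))
  refine Tendsto.congr' ?_ (tendsto_const_nhds.sub (tendsto_finsetSum _ fun i _ =>
    (hl i).mul (tendsto_pi_nhds.1 hinv i)))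
  filter_upwards [hP.eventually_isMonicOrthogonal_perturbedForm_iff hc hφ hterm hκ hdet, hQ, hψ,
    eventually_all.2 hφ, eventually_ne_atTop 0] with n hiff hQn hψn hφn hn
  rw [(hiff _).1 hQn, hP.map_correctedPolynomial hn hψn hφn, mul_div_cancel_left₀ _ hψn]

end Limit

end IsMonicOrthogonalBasis

end Perturbation

section PartialFractions

variable {F ι : Type*} [Field F] [Fintype ι] {y : ι → F}

theorem exists_sum_inv_mul_eq_one_sub_prod (hy : Function.Injective y) (a : ι → F) :
    ∃ v : ι → F, ∀ x, (∀ i, x ≠ y i) →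
      ∑ i, (x - y i)⁻¹ * v i = 1 - ∏ i, (x - a i) / (x - y i) := by
  classical
  set s : Finset ι := Finset.univ
  have hdeg : (Lagrange.nodal s y - Lagrange.nodal s a).degree < s.card :=
    degree_sub_lt_of_monic Lagrange.nodal_monic Lagrange.nodal_monic Lagrange.natDegree_nodal
      Lagrange.natDegree_nodal
  refine ⟨fun i => Lagrange.nodalWeight s y i *
    (Lagrange.nodal s y - Lagrange.nodal s a).eval (y i), fun x hx => ?_⟩
  have heval := congrArg (eval x) (Lagrange.eq_interpolate hy.injOn hdeg)
  have hprod : ∏ i, (x - y i) ≠ 0 := Finset.prod_ne_zero_iff.2 fun i _ => sub_ne_zero.2 (hx i)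
  rw [Lagrange.eval_interpolate_not_at_node _ fun i _ => hx i, eval_sub, Lagrange.eval_nodal,
    Lagrange.eval_nodal] at heval
  rw [Finset.prod_div_distrib, one_sub_div hprod, eq_div_iff hprod, mul_comm, heval]
  exact congrArg _ (Finset.sum_congr rfl fun i _ => by ring)

theorem det_cauchy_ne_zero [DecidableEq ι] {x : ι → F} (hx : Function.Injective x)
    (hy : Function.Injective y) (hxy : ∀ i j, x i ≠ y j) :
    (Matrix.of fun i j => (x i - y j)⁻¹).det ≠ 0 := by
  set s : Finset ι := Finset.univ
  intro hdet
  obtain ⟨v, hv, hker⟩ := Matrix.exists_mulVec_eq_zero_iff.2 hdet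
  refine hv (funext fun j => ?_)
  have hweight (j : ι) := Lagrange.nodalWeight_ne_zero hy.injOn (Finset.mem_univ j)
  set p := Lagrange.interpolate s y fun j => v j / Lagrange.nodalWeight s y j with hp
  have hroot (i : ι) : p.eval (x i) = 0 := by
    rw [hp, Lagrange.eval_interpolate_not_at_node _ fun j _ => hxy i j]
    refine mul_eq_zero_of_right _ (Eq.trans (Finset.sum_congr rfl fun j _ => ?_)
      (congrFun hker i))
    change _ = (x i - y j)⁻¹ * v j
    rw [mul_right_comm, mul_div_cancel₀ _ (hweight j), mul_comm]
  have hzero : p = 0 := eq_zero_of_degree_lt_of_eval_index_eq_zero s hx.injOn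
    (Lagrange.degree_interpolate_lt _ hy.injOn) fun i _ => hroot i
  have heval : p.eval (y j) = _ := Lagrange.eval_interpolate_at_node _ hy.injOn (Finset.mem_univ j)
  rw [hzero, eval_zero, eq_comm, div_eq_zero_iff] at heval
  exact heval.resolve_right (hweight j)

end PartialFractions

section Asymptotics

/-- The asymptotic expansion `u n = 1 + s / n + o(1 / n)`. -/
def OneAddDivAsymptotic (u : ℕ → ℝ) (s : ℝ) : Prop :=
  Tendsto (fun n : ℕ => (n : ℝ) * (u n - 1)) atTop (𝓝 s)

namespace OneAddDivAsymptotic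

variable {u v : ℕ → ℝ} {s t : ℝ}

theorem tendsto_one (hu : OneAddDivAsymptotic u s) : Tendsto u atTop (𝓝 1) := by
  have h : Tendsto (fun n : ℕ => (n : ℝ) * (u n - 1) * (n : ℝ)⁻¹ + 1) atTop (𝓝 (s * 0 + 1)) :=
    (Tendsto.mul hu tendsto_inv_atTop_nhds_zero_nat).add_const 1
  rw [mul_zero, zero_add] at h
  refine h.congr' ?_
  filter_upwards [eventually_ne_atTop 0] with n hn
  rw [mul_right_comm, mul_inv_cancel₀ (Nat.cast_ne_zero.2 hn), one_mul, sub_add_cancel]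

theorem mul (hu : OneAddDivAsymptotic u s) (hv : OneAddDivAsymptotic v t) :
    OneAddDivAsymptotic (fun n => u n * v n) (s + t) := by
  have h := (Tendsto.mul hu hv.tendsto_one).add hv
  rw [mul_one] at h
  exact Tendsto.congr (fun n => by ring) h

theorem congr' (hu : OneAddDivAsymptotic u s) (huv : u =ᶠ[atTop] v) : OneAddDivAsymptotic v s :=
  Tendsto.congr' (huv.mono fun n hn => by simp only [hn]) hu

theorem add_const_div (a b : ℝ) :
    OneAddDivAsymptotic (fun n : ℕ => ((n : ℝ) + a) / (n + b)) (a - b) := by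
  have h : Tendsto (fun n : ℕ => (n : ℝ) / (n + b) * (a - b)) atTop (𝓝 (1 * (a - b))) :=
    (tendsto_natCast_div_add_atTop b).mul_const (a - b)
  rw [one_mul] at h
  refine h.congr' ?_
  filter_upwards [(tendsto_atTop_add_const_right _ b
    tendsto_natCast_atTop_atTop).eventually_ne_atTop 0] with n hn
  rw [div_sub_one hn, add_sub_add_left_eq_sub]
  ring

end OneAddDivAsymptotic

theorem isLittleO_of_tendsto_sub_div_sub {a b : ℕ → ℝ} (hb : ∀ n, b n < b (n + 1))
    (hb_top : Tendsto b atTop atTop)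
    (h : Tendsto (fun n => (a (n + 1) - a n) / (b (n + 1) - b n)) atTop (𝓝 0)) :
    a =o[atTop] b := by
  have hconst (x : ℝ) : (fun _ : ℕ => x) =o[atTop] b :=
    Asymptotics.isLittleO_const_left.2 (Or.inr (tendsto_norm_atTop_atTop.comp hb_top))
  have hsum := ((Asymptotics.isLittleO_iff_tendsto fun n hn =>
    absurd hn (sub_pos.2 (hb n)).ne').2 h).sum_range (fun n => (sub_pos.2 (hb n)).le)
      (by simpa only [Finset.sum_range_sub, ← sub_eq_add_neg] using
        tendsto_atTop_add_const_right _ (-b 0) hb_top)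
  simp only [Finset.sum_range_sub] at hsum
  have hsum' := hsum.trans_isBigO ((Asymptotics.isBigO_refl b _).sub (hconst (b 0)).isBigO)
  simpa only [sub_add_cancel] using hsum'.add (hconst (a 0))

/-- The Stolz–Cesàro theorem. -/
theorem tendsto_div_of_tendsto_sub_div_sub {a b : ℕ → ℝ} {l : ℝ}
    (hb : ∀ᶠ n in atTop, b n < b (n + 1)) (hb_top : Tendsto b atTop atTop)
    (h : Tendsto (fun n => (a (n + 1) - a n) / (b (n + 1) - b n)) atTop (𝓝 l)) :
    Tendsto (fun n => a n / b n) atTop (𝓝 l) := by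
  obtain ⟨N, hN⟩ := eventually_atTop.1 hb
  have hb' (n : ℕ) : b (n + N) < b (n + 1 + N) := by
    rw [add_right_comm]
    exact hN _ (Nat.le_add_left _ _)
  have hlittle : (fun n => a (n + N) - l * b (n + N)) =o[atTop] fun n => b (n + N) := by
    refine isLittleO_of_tendsto_sub_div_sub hb' ((tendsto_add_atTop_iff_nat N).2 hb_top) ?_
    have h' := ((tendsto_add_atTop_iff_nat N).2 h).sub_const l
    rw [sub_self] at h'
    refine h'.congr fun n => ?_
    have := (sub_pos.2 (hb' n)).ne'
    rw [add_right_comm n 1 N] at this ⊢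
    field_simp
    ring
  have hlim := hlittle.tendsto_div_nhds_zero.add_const l
  rw [zero_add] at hlim
  refine (tendsto_add_atTop_iff_nat N).1 (hlim.congr' ?_)
  filter_upwards [((tendsto_add_atTop_iff_nat N).2 hb_top).eventually_ne_atTop 0] with n hn
  rw [sub_div, mul_div_cancel_right₀ _ hn, sub_add_cancel]

/-- `t` is a normalized regularly varying sequence of index `s`: it grows like `n ^ s` in the sense
that `t (n + 1) / t n = 1 + s / n + o(1 / n)`. -/
def IsRegularlyVarying (t : ℕ → ℝ) (s : ℝ) : Prop :=
  OneAddDivAsymptotic (fun n => t (n + 1) / t n) s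

namespace IsRegularlyVarying

variable {t u : ℕ → ℝ} {s r : ℝ}

theorem tendsto_succ_div (h : IsRegularlyVarying t s) :
    Tendsto (fun n => t (n + 1) / t n) atTop (𝓝 1) :=
  OneAddDivAsymptotic.tendsto_one h

theorem eventually_ne_zero (h : IsRegularlyVarying t s) : ∀ᶠ n in atTop, t n ≠ 0 :=
  (h.tendsto_succ_div.eventually_ne one_ne_zero).mono fun _ hn => (div_ne_zero_iff.1 hn).2

theorem exists_eventually_mul_pos (h : IsRegularlyVarying t s) :
    ∃ a, a ≠ 0 ∧ ∀ᶠ n in atTop, 0 < a * t n := by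
  obtain ⟨N, hN⟩ := eventually_atTop.1
    (h.eventually_ne_zero.and (h.tendsto_succ_div.eventually_const_lt one_pos))
  refine ⟨t N, (hN N le_rfl).1, eventually_atTop.2 ⟨N, fun n hn => ?_⟩⟩
  induction n, hn using Nat.le_induction with
  | base => exact mul_self_pos.2 (hN N le_rfl).1
  | succ n hn ih =>
    obtain ⟨htn, hratio⟩ := hN n hn
    have := mul_pos ih hratio
    rwa [mul_assoc, mul_div_cancel₀ _ htn] at this

theorem eventually_lt_succ (h : IsRegularlyVarying t s) (hs : 0 < s)
    (ht : ∀ᶠ n in atTop, 0 < t n) : ∀ᶠ n in atTop, t n < t (n + 1) := by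
  filter_upwards [ht, Tendsto.eventually_const_lt hs h] with n htn hn
  exact (one_lt_div htn).1 (sub_pos.1 (pos_of_mul_pos_right hn n.cast_nonneg))

theorem tendsto_atTop (h : IsRegularlyVarying t s) (hs : 0 < s)
    (ht : ∀ᶠ n in atTop, 0 < t n) : Tendsto t atTop atTop := by
  obtain ⟨N, hN⟩ := eventually_atTop.1 ((ht.and (h.eventually_lt_succ hs ht)).and
    (Tendsto.eventually_const_lt (half_lt_self hs) h))
  have htN : 0 < t N := (hN N le_rfl).1.1
  have hmono : ∀ n ≥ N, t N ≤ t n := fun n hn =>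
    Nat.rel_of_forall_rel_succ_of_le_of_le (· ≤ ·) (fun n hn => (hN n hn).1.2.le) le_rfl hn
  set c := s / 2 * t N with hc
  set H : ℕ → ℝ := fun n => ∑ m ∈ Finset.range n, 1 / ((m : ℝ) + 1) with hH
  have hgap_succ : ∀ n ≥ N, t n - c * H n ≤ t (n + 1) - c * H (n + 1) := fun n hn => by
    obtain ⟨⟨htn, hlt⟩, hn'⟩ := hN n hn
    have hstep : c ≤ (n + 1) * (t (n + 1) - t n) := by
      rw [div_sub_one htn.ne', ← mul_div_assoc, lt_div_iff₀ htn] at hn'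
      nlinarith [hmono n hn]
    have : c * (1 / ((n : ℝ) + 1)) ≤ t (n + 1) - t n := by
      rwa [mul_one_div, div_le_iff₀' (by positivity)]
    simp only [hH, Finset.sum_range_succ]
    linarith
  have hgap : ∀ n ≥ N, t N - c * H N ≤ t n - c * H n := fun n hn =>
    Nat.rel_of_forall_rel_succ_of_le_of_le (· ≤ ·) hgap_succ le_rfl hn
  refine tendsto_atTop_mono' _ (f₁ := fun n => c * H n + (t N - c * H N)) ?_
    (tendsto_atTop_add_const_right _ _
      (Real.tendsto_sum_range_one_div_nat_succ_atTop.const_mul_atTop (by positivity)))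
  filter_upwards [eventually_ge_atTop N] with n hn
  linarith [hgap n hn]

theorem mul (ht : IsRegularlyVarying t s) (hu : IsRegularlyVarying u r) :
    IsRegularlyVarying (fun n => t n * u n) (s + r) := by
  simpa only [IsRegularlyVarying, mul_div_mul_comm] using OneAddDivAsymptotic.mul ht hu

theorem const_mul (h : IsRegularlyVarying t s) {a : ℝ} (ha : a ≠ 0) :
    IsRegularlyVarying (fun n => a * t n) s := by
  simpa only [IsRegularlyVarying, mul_div_mul_left _ _ ha] using h

theorem natCast_add (a : ℝ) : IsRegularlyVarying (fun n => n + a) 1 := by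
  have h := OneAddDivAsymptotic.add_const_div (1 + a) a
  rw [add_sub_cancel_right] at h
  refine h.congr' (Eventually.of_forall fun n => ?_)
  push_cast
  rw [add_assoc]

theorem natCast_mul (h : IsRegularlyVarying t s) :
    IsRegularlyVarying (fun n => n * t n) (s + 1) := by
  simpa only [add_zero, mul_comm] using h.mul (natCast_add 0)

theorem tendsto_natCast_mul_atTop (h : IsRegularlyVarying t s) (hs : -1 < s)
    (ht : ∀ᶠ n in atTop, 0 < t n) : Tendsto (fun n : ℕ => n * t n) atTop atTop := by
  refine h.natCast_mul.tendsto_atTop (by linarith) ?_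
  filter_upwards [ht, eventually_gt_atTop 0] with n htn hn
  exact mul_pos (Nat.cast_pos.2 hn) htn

theorem tendsto_inv_natCast_mul (h : IsRegularlyVarying t s) (hs : -1 < s) :
    Tendsto (fun n : ℕ => (n * t n)⁻¹) atTop (𝓝 0) := by
  obtain ⟨a, ha, hat⟩ := h.exists_eventually_mul_pos
  have hlim := ((h.const_mul ha).tendsto_natCast_mul_atTop hs hat).inv_tendsto_atTop.const_mul a
  rw [mul_zero] at hlim
  refine hlim.congr fun n => ?_
  rw [Pi.inv_apply, mul_left_comm, mul_inv, mul_inv_cancel_left₀ ha]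

theorem tendsto_sum_range_div_natCast_mul (h : IsRegularlyVarying t s) (hs : -1 < s) :
    Tendsto (fun n : ℕ => (∑ m ∈ Finset.range n, t m) / (n * t n)) atTop (𝓝 (s + 1)⁻¹) := by
  wlog ht : ∀ᶠ n in atTop, 0 < t n generalizing t
  · obtain ⟨a, ha, hat⟩ := h.exists_eventually_mul_pos
    refine (this (h.const_mul ha) hat).congr fun n => ?_
    rw [← Finset.mul_sum, mul_left_comm, mul_div_mul_left _ _ ha]
  have htop := h.tendsto_natCast_mul_atTop hs ht
  refine tendsto_div_of_tendsto_sub_div_sub (h.natCast_mul.eventually_lt_succ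
    (by linarith) (htop.eventually_gt_atTop 0)) htop ?_
  refine (Tendsto.inv₀ h.natCast_mul (by linarith)).congr' ?_
  filter_upwards [ht, eventually_ne_atTop 0] with n htn hn
  have hn' : (n : ℝ) ≠ 0 := Nat.cast_ne_zero.2 hn
  rw [Finset.sum_range_succ_sub_sum]
  field_simp

end IsRegularlyVarying

end Asymptotics

section JacobiForm

variable {α β : ℝ}

theorem intervalIntegrable_jacobi_weight (hα : -1 < α) (hβ : -1 < β) :
    IntervalIntegrable (fun x : ℝ => (1 - x) ^ α * (1 + x) ^ β) MeasureTheory.volume (-1) 1 := by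
  have hleft : IntervalIntegrable (fun x : ℝ => (1 - x) ^ α * (1 + x) ^ β)
      MeasureTheory.volume (-1) 0 := by
    refine IntervalIntegrable.continuousOn_mul (f := fun x : ℝ => (1 + x) ^ β) ?_ ?_
    · simpa using (intervalIntegral.intervalIntegrable_rpow' (a := 0) (b := 1) hβ).comp_add_left 1
    · rw [Set.uIcc_of_le (by norm_num)]
      exact ContinuousOn.rpow_const (by fun_prop) fun x hx => Or.inl (by linarith [hx.2])
  have hright : IntervalIntegrable (fun x : ℝ => (1 - x) ^ α * (1 + x) ^ β)
      MeasureTheory.volume 0 1 := by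
    refine IntervalIntegrable.mul_continuousOn (f := fun x : ℝ => (1 - x) ^ α) ?_ ?_
    · simpa using (intervalIntegral.intervalIntegrable_rpow' (a := 1) (b := 0) hα).comp_sub_left 1
    · rw [Set.uIcc_of_le (by norm_num)]
      exact ContinuousOn.rpow_const (by fun_prop) fun x hx => Or.inl (by linarith [hx.1])
  exact hleft.trans hright

theorem intervalIntegrable_eval_mul_jacobi_weight (hα : -1 < α) (hβ : -1 < β) (p : ℝ[X]) :
    IntervalIntegrable (fun x : ℝ => p.eval x * ((1 - x) ^ α * (1 + x) ^ β))
      MeasureTheory.volume (-1) 1 :=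
  (intervalIntegrable_jacobi_weight hα hβ).continuousOn_mul p.continuous.continuousOn

/-- Integration of polynomials against the Jacobi weight, as a linear functional. -/
noncomputable def jacobiFunctional (hα : -1 < α) (hβ : -1 < β) : ℝ[X] →ₗ[ℝ] ℝ where
  toFun p := ∫ x in (-1 : ℝ)..1, p.eval x * ((1 - x) ^ α * (1 + x) ^ β)
  map_add' p q := by
    rw [← intervalIntegral.integral_add (intervalIntegrable_eval_mul_jacobi_weight hα hβ p)
      (intervalIntegrable_eval_mul_jacobi_weight hα hβ q)]
    simp only [eval_add, add_mul]
  map_smul' c p := by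
    rw [RingHom.id_apply, smul_eq_mul, ← intervalIntegral.integral_const_mul]
    simp only [eval_smul, smul_eq_mul, mul_assoc]

/-- `jacobiForm` as a bilinear form. -/
noncomputable def jacobiBilin (hα : -1 < α) (hβ : -1 < β) : LinearMap.BilinForm ℝ ℝ[X] :=
  (LinearMap.mul ℝ ℝ[X]).compr₂ (jacobiFunctional hα hβ)

theorem jacobiBilin_apply_eq_jacobiFunctional (hα : -1 < α) (hβ : -1 < β) (p q : ℝ[X]) :
    jacobiBilin hα hβ p q = jacobiFunctional hα hβ (p * q) :=
  rfl

theorem jacobiBilin_apply (hα : -1 < α) (hβ : -1 < β) (p q : ℝ[X]) :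
    jacobiBilin hα hβ p q = jacobiForm α β p q := by
  simp only [jacobiBilin_apply_eq_jacobiFunctional, jacobiFunctional, jacobiForm,
    LinearMap.coe_mk, AddHom.coe_mk, eval_mul]

theorem isSymm_jacobiBilin (hα : -1 < α) (hβ : -1 < β) : (jacobiBilin hα hβ).IsSymm :=
  ⟨fun p q => by simp only [jacobiBilin_apply_eq_jacobiFunctional, mul_comm]⟩

theorem jacobi_weight_pos {x : ℝ} (hx : x ∈ Set.Ioo (-1 : ℝ) 1) :
    0 < (1 - x) ^ α * (1 + x) ^ β :=
  mul_pos (Real.rpow_pos_of_pos (by linarith [hx.2]) _)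
    (Real.rpow_pos_of_pos (by linarith [hx.1]) _)

theorem jacobiBilin_self_pos (hα : -1 < α) (hβ : -1 < β) {p : ℝ[X]} (hp : p ≠ 0) :
    0 < jacobiBilin hα hβ p p := by
  have hsub : Set.Ioo (-1 : ℝ) 1 \ {x | p.IsRoot x} ⊆
      Function.support (fun x => (p * p).eval x * ((1 - x) ^ α * (1 + x) ^ β)) ∩
        Set.Ioc (-1) 1 := by
    rintro x ⟨hx, hroot⟩
    refine ⟨?_, hx.1, hx.2.le⟩
    rw [Function.mem_support, eval_mul]
    exact mul_ne_zero (mul_self_ne_zero.2 hroot) (jacobi_weight_pos hx).ne'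
  have hnonneg : ∀ x ∈ Set.uIoc (-1 : ℝ) 1,
      0 ≤ (p * p).eval x * ((1 - x) ^ α * (1 + x) ^ β) := by
    intro x hx
    rw [Set.uIoc_of_le (by norm_num)] at hx
    rw [eval_mul]
    exact mul_nonneg (mul_self_nonneg _) (mul_nonneg (Real.rpow_nonneg (by linarith [hx.2]) _)
      (Real.rpow_nonneg (by linarith [hx.1]) _))
  have hpos : 0 < ∫ x in (-1 : ℝ)..1, (p * p).eval x * ((1 - x) ^ α * (1 + x) ^ β) := by
    rw [intervalIntegral.integral_pos_iff_support_of_nonneg_ae'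
      (MeasureTheory.ae_restrict_of_forall_mem measurableSet_uIoc hnonneg)
      (intervalIntegrable_eval_mul_jacobi_weight hα hβ _)]
    refine ⟨by norm_num, lt_of_lt_of_le ?_ (MeasureTheory.measure_mono hsub)⟩
    rw [MeasureTheory.measure_sdiff_null ((finite_setOfPred_isRoot hp).measure_zero _)]
    simp
  exact hpos

end JacobiForm

section JacobiOperator

variable {α β : ℝ}

/-- The Jacobi differential operator `p ↦ (1 - x²) p'' + (β - α - (α + β + 2) x) p'`. -/
noncomputable def jacobiOperator (α β : ℝ) (p : ℝ[X]) : ℝ[X] :=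
  (1 - X ^ 2) * derivative (derivative p) +
    (C (β - α) - C (α + β + 2) * X) * derivative p

theorem hasDerivAt_jacobi_weight_mul_wronskian (p q : ℝ[X]) {x : ℝ}
    (hx : x ∈ Set.Ioo (-1 : ℝ) 1) :
    HasDerivAt
      (fun x => (1 - x) ^ (α + 1) * (1 + x) ^ (β + 1) *
        (derivative p * q - p * derivative q).eval x)
      ((jacobiOperator α β p * q - p * jacobiOperator α β q).eval x *
        ((1 - x) ^ α * (1 + x) ^ β)) x := by
  have hx₁ : 1 - x ≠ 0 := by linarith [hx.2]
  have hx₂ : 1 + x ≠ 0 := by linarith [hx.1]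
  have hleft : HasDerivAt (fun x : ℝ => (1 - x) ^ (α + 1)) (-1 * (α + 1) * (1 - x) ^ α) x := by
    simpa using ((hasDerivAt_id x).const_sub 1).rpow_const (p := α + 1) (Or.inl hx₁)
  have hright : HasDerivAt (fun x : ℝ => (1 + x) ^ (β + 1)) (1 * (β + 1) * (1 + x) ^ β) x := by
    simpa using ((hasDerivAt_id x).const_add 1).rpow_const (p := β + 1) (Or.inl hx₂)
  refine ((hleft.mul hright).mul
    ((derivative p * q - p * derivative q).hasDerivAt x)).congr_deriv ?_
  rw [Pi.mul_apply, Real.rpow_add_one hx₁, Real.rpow_add_one hx₂]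
  simp only [jacobiOperator, derivative_sub, derivative_mul, eval_sub, eval_add, eval_mul,
    eval_pow, eval_X, eval_C, eval_one]
  ring

theorem jacobiBilin_jacobiOperator (hα : -1 < α) (hβ : -1 < β) (p q : ℝ[X]) :
    jacobiBilin hα hβ (jacobiOperator α β p) q = jacobiBilin hα hβ p (jacobiOperator α β q) := by
  rw [← sub_eq_zero, jacobiBilin_apply_eq_jacobiFunctional,
    jacobiBilin_apply_eq_jacobiFunctional, ← map_sub]
  have hcont : ContinuousOn (fun x : ℝ => (1 - x) ^ (α + 1) * (1 + x) ^ (β + 1) *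
      (derivative p * q - p * derivative q).eval x) (Set.Icc (-1) 1) := by
    refine ContinuousOn.mul (ContinuousOn.mul ?_ ?_) (Polynomial.continuous _).continuousOn
    · exact ContinuousOn.rpow_const (by fun_prop) fun x _ => Or.inr (by linarith)
    · exact ContinuousOn.rpow_const (by fun_prop) fun x _ => Or.inr (by linarith)
  refine (intervalIntegral.integral_eq_sub_of_hasDerivAt_of_le (by norm_num) hcont
    (fun x hx => hasDerivAt_jacobi_weight_mul_wronskian p q hx)
    (intervalIntegrable_eval_mul_jacobi_weight hα hβ _)).trans ?_
  have hα' : α + 1 ≠ 0 := by linarith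
  have hβ' : β + 1 ≠ 0 := by linarith
  simp [Real.zero_rpow hα', Real.zero_rpow hβ']

theorem coeff_X_mul_derivative {R : Type*} [CommSemiring R] (p : R[X]) (m : ℕ) :
    (X * derivative p).coeff m = m * p.coeff m := by
  cases m with
  | zero => simp
  | succ m => rw [coeff_X_mul, coeff_derivative, mul_comm, Nat.cast_succ]

theorem jacobiOperator_eq (p : ℝ[X]) :
    jacobiOperator α β p = derivative (derivative p) + C (β - α) * derivative p -
      (X * derivative (X * derivative p) + C (α + β + 1) * (X * derivative p)) := by
  simp only [jacobiOperator, derivative_mul, derivative_X, C_add, map_ofNat, C_1]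
  ring

theorem coeff_jacobiOperator {p : ℝ[X]} {m : ℕ} (hp : p.natDegree ≤ m) :
    (jacobiOperator α β p).coeff m = -(m * (m + (α + β + 1))) * p.coeff m := by
  have hderiv (q : ℝ[X]) (hq : q.natDegree ≤ m) : (derivative q).coeff m = 0 := by
    rw [coeff_derivative, coeff_eq_zero_of_natDegree_lt (Nat.lt_succ_of_le hq), zero_mul]
  rw [jacobiOperator_eq]
  simp only [coeff_sub, coeff_add, coeff_C_mul, coeff_X_mul_derivative]
  rw [hderiv p hp, hderiv _ ((natDegree_derivative_le p).trans ((Nat.sub_le _ _).trans hp))]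
  ring

theorem natDegree_jacobiOperator_le (p : ℝ[X]) :
    (jacobiOperator α β p).natDegree ≤ p.natDegree := by
  refine natDegree_le_iff_coeff_eq_zero.2 fun m hm => ?_
  rw [coeff_jacobiOperator hm.le, coeff_eq_zero_of_natDegree_lt hm, mul_zero]

end JacobiOperator

section MonicJacobi

variable {α β : ℝ}

/-- The monic Jacobi polynomial of degree `n`. -/
noncomputable def monicJacobi (α β : ℝ) (n : ℕ) : ℝ[X] :=
  monicOrthogonal (jacobiForm α β) n

theorem isMonicOrthogonalBasis_monicJacobi (hα : -1 < α) (hβ : -1 < β) :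
    IsMonicOrthogonalBasis (jacobiBilin hα hβ) (monicJacobi α β) := by
  have hanisotropic (p : ℝ[X]) (hp : jacobiBilin hα hβ p p = 0) : p = 0 :=
    of_not_not fun hp0 => (jacobiBilin_self_pos hα hβ hp0).ne' hp
  refine .of_anisotropic (isSymm_jacobiBilin hα hβ) hanisotropic fun n => ?_
  have hex := existsUnique_isMonicOrthogonal hanisotropic n
  simp only [jacobiBilin_apply] at hex ⊢
  exact isMonicOrthogonal_monicOrthogonal hex

theorem jacobiOperator_monicJacobi (hα : -1 < α) (hβ : -1 < β) (n : ℕ) :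
    jacobiOperator α β (monicJacobi α β n) =
      C (-(n * (n + (α + β + 1)))) * monicJacobi α β n := by
  have hP := isMonicOrthogonalBasis_monicJacobi hα hβ
  have hn := hP.isMonicOrthogonal n
  rw [hP.map_eq_C_coeff_mul (jacobiBilin_jacobiOperator hα hβ) natDegree_jacobiOperator_le n,
    coeff_jacobiOperator hn.2.1.le, hn.coeff_self, mul_one]

theorem iterate_derivative_monicJacobi_equation (hα : -1 < α) (hβ : -1 < β) (j n : ℕ) :
    (1 - X ^ 2) * derivative^[j + 2] (monicJacobi α β n) +
      (C (β - α) - C (α + β + 2 + 2 * j) * X) * derivative^[j + 1] (monicJacobi α β n) +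
      C (n * (n + (α + β + 1)) - j * (j + (α + β + 1))) * derivative^[j] (monicJacobi α β n) =
        0 := by
  induction j with
  | zero =>
    have h := jacobiOperator_monicJacobi hα hβ n
    rw [jacobiOperator, C_neg, neg_mul, ← add_eq_zero_iff_eq_neg] at h
    simpa using h
  | succ j ih =>
    have h := congrArg derivative ih
    simp only [derivative_add, derivative_mul, derivative_sub, derivative_C, derivative_X,
      derivative_one, derivative_X_pow, derivative_zero, ← Function.iterate_succ_apply'] at h
    rw [← h]
    simp only [C_add, C_sub, C_mul, map_natCast, Nat.cast_add, Nat.cast_one, Nat.succ_eq_add_one,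
      map_ofNat, map_one, add_assoc, Nat.reduceAdd, Nat.reduceSub, pow_one, Nat.cast_ofNat]
    ring

/-- The value of the `j`-th derivative at `-1`, as a linear functional. -/
noncomputable def derivEval (j : ℕ) : ℝ[X] →ₗ[ℝ] ℝ :=
  leval (-1) ∘ₗ derivative ^ j

theorem derivEval_apply (j : ℕ) (p : ℝ[X]) :
    derivEval j p = (derivative^[j] p).eval (-1) := by
  rw [derivEval, LinearMap.comp_apply, Module.End.pow_apply, leval_apply]

theorem derivEval_succ_monicJacobi (hα : -1 < α) (hβ : -1 < β) (j n : ℕ) :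
    derivEval (j + 1) (monicJacobi α β n) =
      -((n - j) * (n + j + (α + β + 1)) / (2 * (β + 1 + j))) *
        derivEval j (monicJacobi α β n) := by
  have h := congrArg (eval (-1)) (iterate_derivative_monicJacobi_equation hα hβ j n)
  simp only [eval_add, eval_mul, eval_sub, eval_one, eval_pow, eval_X, eval_C, eval_zero,
    ← derivEval_apply] at h
  have hj : 2 * (β + 1 + j) ≠ 0 := by linarith [j.cast_nonneg (α := ℝ)]
  rw [← neg_div, div_mul_eq_mul_div, eq_div_iff hj]
  linear_combination h

theorem derivEval_monicJacobi_mul (hα : -1 < α) (hβ : -1 < β) (j n : ℕ) :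
    derivEval j (monicJacobi α β n) * (ascPochhammer ℝ j).eval (β + 1) * (-2) ^ j =
      n.descFactorial j * (ascPochhammer ℝ j).eval (n + (α + β + 1)) *
        derivEval 0 (monicJacobi α β n) := by
  induction j with
  | zero => simp
  | succ j ih =>
    have hj : β + 1 + (j : ℝ) ≠ 0 := by linarith [j.cast_nonneg (α := ℝ)]
    have hsucc : derivEval (j + 1) (monicJacobi α β n) * (β + 1 + j) * (-2) =
        (n - j) * (n + j + (α + β + 1)) * derivEval j (monicJacobi α β n) := by
      rw [derivEval_succ_monicJacobi hα hβ]
      field_simp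
    rw [← descPochhammer_eval_eq_descFactorial ℝ] at ih ⊢
    rw [descPochhammer_succ_eval, ascPochhammer_succ_eval, ascPochhammer_succ_eval]
    linear_combination (ascPochhammer ℝ j).eval (β + 1) * (-2) ^ j * hsucc +
      (n - j) * (n + j + (α + β + 1)) * ih

theorem ascPochhammer_eval_self_add_pos (hα : -1 < α) (hβ : -1 < β) (n : ℕ) :
    0 < (ascPochhammer ℝ n).eval (n + (α + β + 1)) := by
  rcases n.eq_zero_or_pos with rfl | hn
  · simp
  · have hn' : (1 : ℝ) ≤ n := by exact_mod_cast hn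
    exact ascPochhammer_pos n _ (by linarith)

theorem derivEval_self_of_isMonicOrthogonal {B : ℝ[X] → ℝ[X] → ℝ} {n : ℕ} {q : ℝ[X]}
    (hq : IsMonicOrthogonal B n q) : derivEval n q = n.factorial := by
  have hdeg : (derivative^[n] q).natDegree ≤ 0 := by
    have := natDegree_iterate_derivative q n
    have := hq.2.1
    omega
  rw [derivEval_apply, eq_C_of_natDegree_le_zero hdeg, eval_C, coeff_iterate_derivative, zero_add,
    Nat.descFactorial_self, hq.coeff_self, nsmul_one]

theorem derivEval_zero_monicJacobi_mul (hα : -1 < α) (hβ : -1 < β) (n : ℕ) :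
    derivEval 0 (monicJacobi α β n) * (ascPochhammer ℝ n).eval (n + (α + β + 1)) =
      (-2) ^ n * (ascPochhammer ℝ n).eval (β + 1) := by
  have hfact : (n.factorial : ℝ) ≠ 0 := Nat.cast_ne_zero.2 n.factorial_ne_zero
  have h := derivEval_monicJacobi_mul hα hβ n n
  rw [derivEval_self_of_isMonicOrthogonal
    ((isMonicOrthogonalBasis_monicJacobi hα hβ).isMonicOrthogonal n), Nat.descFactorial_self] at h
  refine mul_left_cancel₀ hfact ?_
  linear_combination -h

theorem derivEval_zero_monicJacobi_ne_zero (hα : -1 < α) (hβ : -1 < β) (n : ℕ) :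
    derivEval 0 (monicJacobi α β n) ≠ 0 := by
  refine left_ne_zero_of_mul (b := (ascPochhammer ℝ n).eval (n + (α + β + 1))) ?_
  rw [derivEval_zero_monicJacobi_mul hα hβ]
  exact mul_ne_zero (by positivity) (ascPochhammer_pos n _ (by linarith)).ne'

theorem ascPochhammer_succ_eval_succ_mul (n : ℕ) (x : ℝ) :
    (n + x) * (ascPochhammer ℝ (n + 1)).eval (n + 1 + x) =
      (ascPochhammer ℝ n).eval (n + x) * ((2 * n + x) * (2 * n + 1 + x)) := by
  have h := congrArg (eval (n + x)) (ascPochhammer_succ_left ℝ (n + 1))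
  rw [eval_mul, eval_X, eval_comp, eval_add, eval_X, eval_one, ascPochhammer_succ_eval,
    ascPochhammer_succ_eval, add_right_comm (n : ℝ) x 1] at h
  rw [← h]
  push_cast
  ring

theorem derivEval_zero_monicJacobi_succ (hα : -1 < α) (hβ : -1 < β) (n : ℕ) :
    derivEval 0 (monicJacobi α β (n + 1)) *
        ((2 * n + (α + β + 1)) * (2 * n + 1 + (α + β + 1))) =
      -2 * (β + 1 + n) * (n + (α + β + 1)) * derivEval 0 (monicJacobi α β n) := by
  have hn := derivEval_zero_monicJacobi_mul hα hβ n
  have hsucc := derivEval_zero_monicJacobi_mul hα hβ (n + 1)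
  have hasc := ascPochhammer_succ_eval_succ_mul n (α + β + 1)
  rw [ascPochhammer_succ_eval n (β + 1), pow_succ, Nat.cast_succ] at hsucc
  refine mul_left_cancel₀ (ascPochhammer_eval_self_add_pos hα hβ n).ne' ?_
  linear_combination -derivEval 0 (monicJacobi α β (n + 1)) * hasc +
    ((n : ℝ) + (α + β + 1)) * hsucc + (2 * (β + 1 + n) * (n + (α + β + 1))) * hn

end MonicJacobi

section JacobiKernel

variable {α β : ℝ}

theorem monicJacobi_norm_ratio_mul (hα : -1 < α) (hβ : -1 < β) (n : ℕ) :
    jacobiBilin hα hβ (monicJacobi α β (n + 1)) (monicJacobi α β (n + 1)) /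
          jacobiBilin hα hβ (monicJacobi α β n) (monicJacobi α β n) *
        (2 * n + 1 + (α + β + 1)) * derivEval 0 (monicJacobi α β n) =
      2 * (β + 1) * derivEval 0 (monicJacobi α β (n + 1)) +
        (2 * n + 3 + (α + β + 1)) * derivEval 0 (monicJacobi α β (n + 2)) := by
  obtain ⟨b, hb⟩ := (isMonicOrthogonalBasis_monicJacobi hα hβ).exists_three_term_recurrence (-1)
    (fun p q => by
      rw [jacobiBilin_apply_eq_jacobiFunctional, jacobiBilin_apply_eq_jacobiFunctional,
        mul_assoc, mul_left_comm]) n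
  generalize jacobiBilin hα hβ (monicJacobi α β (n + 1)) (monicJacobi α β (n + 1)) /
    jacobiBilin hα hβ (monicJacobi α β n) (monicJacobi α β n) = r at *
  have hvalue : 0 = derivEval 0 (monicJacobi α β (n + 2)) +
      b * derivEval 0 (monicJacobi α β (n + 1)) + r * derivEval 0 (monicJacobi α β n) := by
    have h := congrArg (derivEval 0) hb
    simpa [derivEval_apply] using h
  have hderiv : derivEval 0 (monicJacobi α β (n + 1)) = derivEval 1 (monicJacobi α β (n + 2)) +
      b * derivEval 1 (monicJacobi α β (n + 1)) + r * derivEval 1 (monicJacobi α β n) := by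
    have h := congrArg (derivEval 1) hb
    simpa [derivEval_apply, derivative_mul] using h
  have hβ' : β + 1 ≠ 0 := by linarith
  simp only [derivEval_succ_monicJacobi hα hβ 0, Nat.cast_zero, add_zero, sub_zero] at hderiv
  push_cast at hderiv
  field_simp at hderiv
  linear_combination -(n + 1 : ℝ) * (n + 1 + (α + β + 1)) * hvalue - hderiv

theorem monicJacobi_norm_ratio (hα : -1 < α) (hβ : -1 < β) (n : ℕ) :
    jacobiBilin hα hβ (monicJacobi α β (n + 1)) (monicJacobi α β (n + 1)) /
        jacobiBilin hα hβ (monicJacobi α β n) (monicJacobi α β n) =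
      -2 * (n + 1) * (n + (α + 1)) * derivEval 0 (monicJacobi α β (n + 1)) /
        ((2 * n + 1 + (α + β + 1)) * (2 * n + 2 + (α + β + 1)) *
          derivEval 0 (monicJacobi α β n)) := by
  have h := monicJacobi_norm_ratio_mul hα hβ n
  have hsucc := derivEval_zero_monicJacobi_succ hα hβ (n + 1)
  push_cast at hsucc
  have h₁ : 2 * (n : ℝ) + 1 + (α + β + 1) ≠ 0 := by linarith [n.cast_nonneg (α := ℝ)]
  have h₂ : 2 * (n : ℝ) + 2 + (α + β + 1) ≠ 0 := by linarith [n.cast_nonneg (α := ℝ)]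
  rw [eq_div_iff (mul_ne_zero (mul_ne_zero h₁ h₂) (derivEval_zero_monicJacobi_ne_zero hα hβ n))]
  linear_combination (2 * n + 2 + (α + β + 1)) * h + hsucc

theorem kernelTerm_derivEval_zero_zero_ratio (hα : -1 < α) (hβ : -1 < β) {n : ℕ} (hn : n ≠ 0) :
    kernelTerm (jacobiBilin hα hβ) (monicJacobi α β) (derivEval 0) (derivEval 0) (n + 1) /
        kernelTerm (jacobiBilin hα hβ) (monicJacobi α β) (derivEval 0) (derivEval 0) n =
      (n + (β + 1)) / (n + 1) * ((n + (α + β + 1)) / (n + (α + 1))) *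
        ((n + (1 + (α + β + 1) / 2)) / (n + (α + β + 1) / 2)) := by
  have hn' : (1 : ℝ) ≤ n := by exact_mod_cast Nat.one_le_iff_ne_zero.2 hn
  have hvalue := derivEval_zero_monicJacobi_succ hα hβ n
  have hx₀ := derivEval_zero_monicJacobi_ne_zero hα hβ n
  have hx₁ := derivEval_zero_monicJacobi_ne_zero hα hβ (n + 1)
  have h₁ : 2 * (n : ℝ) + (α + β + 1) ≠ 0 := by linarith
  have h₂ : 2 * (n : ℝ) + 1 + (α + β + 1) ≠ 0 := by linarith
  have h₃ : (n : ℝ) + (α + 1) ≠ 0 := by linarith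
  have hnorm := monicJacobi_norm_ratio hα hβ n
  rw [kernelTerm, kernelTerm, div_div_div_comm, hnorm]
  generalize derivEval 0 (monicJacobi α β n) = x₀ at *
  generalize derivEval 0 (monicJacobi α β (n + 1)) = x₁ at *
  have hx : x₁ = -2 * (β + 1 + n) * (n + (α + β + 1)) * x₀ /
      ((2 * n + (α + β + 1)) * (2 * n + 1 + (α + β + 1))) := by
    rw [eq_div_iff (mul_ne_zero h₁ h₂), hvalue]
  calc x₁ * x₁ / (x₀ * x₀) / (-2 * (n + 1) * (n + (α + 1)) * x₁ /
        ((2 * n + 1 + (α + β + 1)) * (2 * n + 2 + (α + β + 1)) * x₀))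
      = x₁ * ((2 * n + 1 + (α + β + 1)) * (2 * n + 2 + (α + β + 1))) /
          (x₀ * (-2 * (n + 1) * (n + (α + 1)))) := by field_simp
    _ = _ := by
      rw [hx]
      field_simp
      ring

theorem isRegularlyVarying_kernelTerm_derivEval_zero_zero (hα : -1 < α) (hβ : -1 < β) :
    IsRegularlyVarying
      (kernelTerm (jacobiBilin hα hβ) (monicJacobi α β) (derivEval 0) (derivEval 0))
      (2 * β + 1) := by
  have h := ((OneAddDivAsymptotic.add_const_div (β + 1) 1).mul
    (.add_const_div (α + β + 1) (α + 1))).mul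
    (.add_const_div (1 + (α + β + 1) / 2) ((α + β + 1) / 2))
  rw [show β + 1 - 1 + (α + β + 1 - (α + 1)) + (1 + (α + β + 1) / 2 - (α + β + 1) / 2) =
    2 * β + 1 by ring] at h
  refine h.congr' ?_
  filter_upwards [eventually_ne_atTop 0] with n hn
  exact (kernelTerm_derivEval_zero_zero_ratio hα hβ hn).symm

theorem isRegularlyVarying_kernelTerm_derivEval_succ (hα : -1 < α) (hβ : -1 < β) {i : ℕ}
    {φ : ℝ[X] →ₗ[ℝ] ℝ} {s : ℝ}
    (h : IsRegularlyVarying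
      (kernelTerm (jacobiBilin hα hβ) (monicJacobi α β) (derivEval i) φ) s) :
    IsRegularlyVarying
      (kernelTerm (jacobiBilin hα hβ) (monicJacobi α β) (derivEval (i + 1)) φ) (s + 2) := by
  have hi : -(2 * (β + 1 + i))⁻¹ ≠ 0 := neg_ne_zero.2 (inv_ne_zero
    (by linarith [i.cast_nonneg (α := ℝ)]))
  have hmul := ((h.mul (.natCast_add (-i))).mul (.natCast_add (i + (α + β + 1)))).const_mul hi
  rw [add_assoc s, one_add_one_eq_two] at hmul
  convert hmul using 2 with n
  rw [kernelTerm, kernelTerm, derivEval_succ_monicJacobi hα hβ]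
  ring

theorem kernelTerm_comm (B : LinearMap.BilinForm ℝ ℝ[X]) (P : ℕ → ℝ[X])
    (φ ψ : ℝ[X] →ₗ[ℝ] ℝ) : kernelTerm B P φ ψ = kernelTerm B P ψ φ := by
  funext m
  rw [kernelTerm, kernelTerm, mul_comm]

theorem isRegularlyVarying_kernelTerm_derivEval (hα : -1 < α) (hβ : -1 < β) (i j : ℕ) :
    IsRegularlyVarying
      (kernelTerm (jacobiBilin hα hβ) (monicJacobi α β) (derivEval i) (derivEval j))
      (2 * β + 1 + 2 * i + 2 * j) := by
  induction i with
  | zero =>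
    rw [kernelTerm_comm]
    induction j with
    | zero => simpa using isRegularlyVarying_kernelTerm_derivEval_zero_zero hα hβ
    | succ j ih =>
      rw [Nat.cast_succ, mul_add_one, ← add_assoc]
      exact isRegularlyVarying_kernelTerm_derivEval_succ hα hβ ih
  | succ i ih =>
    rw [Nat.cast_succ, mul_add_one, ← add_assoc, add_right_comm _ 2]
    exact isRegularlyVarying_kernelTerm_derivEval_succ hα hβ ih

theorem eventually_derivEval_monicJacobi_ne_zero (hα : -1 < α) (hβ : -1 < β) (j : ℕ) :
    ∀ᶠ n in atTop, derivEval j (monicJacobi α β n) ≠ 0 := by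
  filter_upwards [(isRegularlyVarying_kernelTerm_derivEval hα hβ j j).eventually_ne_zero] with n hn
  exact left_ne_zero_of_mul (div_ne_zero_iff.1 hn).1

theorem tendsto_inv_natCast_mul_kernelTerm_derivEval (hα : -1 < α) (hβ : -1 < β) (i j : ℕ) :
    Tendsto (fun n : ℕ =>
      (n * kernelTerm (jacobiBilin hα hβ) (monicJacobi α β) (derivEval i) (derivEval j) n)⁻¹)
      atTop (𝓝 0) :=
  (isRegularlyVarying_kernelTerm_derivEval hα hβ i j).tendsto_inv_natCast_mul
    (by linarith [i.cast_nonneg (α := ℝ), j.cast_nonneg (α := ℝ)])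

/-- The limit is written as an entry of the Cauchy matrix with nodes `2 j` and `-2 (β + 1 + i)`. -/
theorem tendsto_normalizedKernel_derivEval (hα : -1 < α) (hβ : -1 < β) (i j : ℕ) :
    Tendsto (normalizedKernel (jacobiBilin hα hβ) (monicJacobi α β) (derivEval i) (derivEval j))
      atTop (𝓝 (2 * j - -(2 * (β + 1 + i)))⁻¹) := by
  have h := (isRegularlyVarying_kernelTerm_derivEval hα hβ i j).tendsto_sum_range_div_natCast_mul
    (by linarith [i.cast_nonneg (α := ℝ), j.cast_nonneg (α := ℝ)])
  rwa [show 2 * β + 1 + 2 * i + 2 * j + 1 = 2 * j - -(2 * (β + 1 + i)) by ring] at h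

end JacobiKernel

section DerivativeMasses

variable {ι : Type*} {α β : ℝ} {d : ι → ℕ}

theorem two_mul_natCast_ne (hβ : -1 < β) (m k : ℕ) : 2 * (m : ℝ) ≠ -(2 * (β + 1 + k)) := by
  linarith [m.cast_nonneg (α := ℝ), k.cast_nonneg (α := ℝ)]

theorem injective_neg_two_mul_add_natCast (β : ℝ) (hd : Function.Injective d) :
    Function.Injective fun i => -(2 * (β + 1 + (d i : ℝ))) := fun i k h =>
  hd (by exact_mod_cast add_left_cancel (mul_left_cancel₀ two_ne_zero (neg_injective h)))

variable [Fintype ι] {c : ι → ℝ}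

/-- The Jacobi form with additional masses `c i` at the derivatives of order `d i` at the point
`-1`. -/
noncomputable def jacobiFormWithMasses (α β : ℝ) (d : ι → ℕ) (c : ι → ℝ) (p q : ℝ[X]) : ℝ :=
  jacobiForm α β p q +
    ∑ i, c i * (derivative^[d i] p).eval (-1) * (derivative^[d i] q).eval (-1)

theorem perturbedForm_jacobiBilin_derivEval (hα : -1 < α) (hβ : -1 < β) :
    perturbedForm (jacobiBilin hα hβ) c (fun i => derivEval (d i)) =
      jacobiFormWithMasses α β d c := by
  funext p q
  simp only [perturbedForm, jacobiFormWithMasses, jacobiBilin_apply, derivEval_apply]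

theorem det_normalizedKernel_limit_ne_zero [DecidableEq ι] (hβ : -1 < β)
    (hd : Function.Injective d) :
    (Matrix.of fun i j => (2 * (d i : ℝ) - -(2 * (β + 1 + d j)))⁻¹).det ≠ 0 :=
  det_cauchy_ne_zero (fun i j h => hd (by exact_mod_cast mul_left_cancel₀ two_ne_zero h))
    (injective_neg_two_mul_add_natCast β hd) fun i j => two_mul_natCast_ne hβ (d i) (d j)

theorem eventually_existsUnique_isMonicOrthogonal_jacobiFormWithMasses (hα : -1 < α) (hβ : -1 < β)
    (hd : Function.Injective d) (hc : ∀ i, c i ≠ 0) :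
    ∀ᶠ n in atTop, ∃! q, IsMonicOrthogonal (jacobiFormWithMasses α β d c) n q := by
  classical
  have hP := isMonicOrthogonalBasis_monicJacobi hα hβ
  have h := hP.eventually_isMonicOrthogonal_perturbedForm_iff hc
    (fun i => eventually_derivEval_monicJacobi_ne_zero hα hβ (d i))
    (fun i => tendsto_inv_natCast_mul_kernelTerm_derivEval hα hβ (d i) (d i))
    (fun i j => tendsto_normalizedKernel_derivEval hα hβ (d j) (d i))
    (det_normalizedKernel_limit_ne_zero hβ hd)
  rw [perturbedForm_jacobiBilin_derivEval] at h
  exact h.mono fun n hn => ⟨_, (hn _).2 rfl, fun q hq => (hn q).1 hq⟩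

theorem tendsto_derivEval_div_derivEval_monicJacobi (hα : -1 < α) (hβ : -1 < β)
    (hd : Function.Injective d) (hc : ∀ i, c i ≠ 0) {Q : ℕ → ℝ[X]}
    (hQ : ∀ᶠ n in atTop, IsMonicOrthogonal (jacobiFormWithMasses α β d c) n (Q n)) (j : ℕ) :
    Tendsto (fun n => derivEval j (Q n) / derivEval j (monicJacobi α β n)) atTop
      (𝓝 (∏ i, ((j : ℝ) - d i) / (β + 1 + j + d i))) := by
  classical
  obtain ⟨v, hv⟩ := exists_sum_inv_mul_eq_one_sub_prod
    (injective_neg_two_mul_add_natCast β hd) fun i => 2 * (d i : ℝ)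
  have hsolution : (Matrix.of fun i k => (2 * (d i : ℝ) - -(2 * (β + 1 + d k)))⁻¹).mulVec v = 1 :=
    funext fun i => (hv _ fun k => two_mul_natCast_ne hβ (d i) (d k)).trans (by
      rw [Finset.prod_eq_zero (Finset.mem_univ i) (by rw [sub_self, zero_div]), sub_zero,
        Pi.one_apply])
  rw [← perturbedForm_jacobiBilin_derivEval hα hβ] at hQ
  have h := (isMonicOrthogonalBasis_monicJacobi hα hβ).tendsto_map_div_map hc
    (fun i => eventually_derivEval_monicJacobi_ne_zero hα hβ (d i))
    (eventually_derivEval_monicJacobi_ne_zero hα hβ j)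
    (fun i => tendsto_inv_natCast_mul_kernelTerm_derivEval hα hβ (d i) (d i))
    (fun i k => tendsto_normalizedKernel_derivEval hα hβ (d k) (d i))
    (fun i => tendsto_normalizedKernel_derivEval hα hβ (d i) j)
    (det_normalizedKernel_limit_ne_zero hβ hd) hsolution hQ
  rw [hv _ fun k => two_mul_natCast_ne hβ j (d k), sub_sub_cancel] at h
  convert h using 3 with i
  rw [← mul_sub, sub_neg_eq_add, ← mul_add, mul_div_mul_left _ _ two_ne_zero]
  ring

end DerivativeMasses

theorem jacobiScale_ne_zero {α β : ℝ} (hα : -1 < α) (hβ : -1 < β) (n : ℕ) :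
    jacobiScale α β n ≠ 0 := by
  have hnum := ascPochhammer_eval_self_add_pos hα hβ n
  rw [← add_assoc, ← add_assoc] at hnum
  exact div_ne_zero hnum.ne' (mul_ne_zero (pow_ne_zero n two_ne_zero)
    (ascPochhammer_pos n _ (by linarith)).ne')

theorem sobolevForm_eq_jacobiFormWithMasses (α β M N : ℝ) :
    sobolevForm α β (-1) M N =
      jacobiFormWithMasses α β (fun i : Fin 2 => (i : ℕ)) ![M, N] := by
  funext p q
  simp [sobolevForm, jacobiFormWithMasses, Fin.sum_univ_two, add_assoc]

theorem proposition4p4_general {ι : Type*} [Fintype ι] {α β : ℝ} (hα : -1 < α) (hβ : -1 < β)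
    {d : ι → ℕ} (hd : Function.Injective d) {c : ι → ℝ} (hc : ∀ i, c i ≠ 0) :
    (∀ᶠ n : ℕ in atTop, ∃! q : ℝ[X], IsMonicOrthogonal (jacobiFormWithMasses α β d c) n q) ∧
    ∀ j : ℕ,
      (∀ᶠ n : ℕ in atTop, (derivative^[j] (scaledJacobi α β n)).eval (-1) ≠ 0) ∧
      Tendsto
        (fun n : ℕ => (derivative^[j] (C (jacobiScale α β n) *
            monicOrthogonal (jacobiFormWithMasses α β d c) n)).eval (-1) /
          (derivative^[j] (scaledJacobi α β n)).eval (-1))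
        atTop
        (𝓝 (∏ i, ((j : ℝ) - d i) / (β + 1 + j + d i))) := by
  have hscale := jacobiScale_ne_zero hα hβ
  have hunique := eventually_existsUnique_isMonicOrthogonal_jacobiFormWithMasses hα hβ hd hc
  have hQ := hunique.mono fun n hn => isMonicOrthogonal_monicOrthogonal hn
  simp only [scaledJacobi, ← smul_eq_C_mul, ← derivEval_apply, map_smul, smul_eq_mul]
  refine ⟨hunique, fun j => ⟨?_, ?_⟩⟩
  · exact (eventually_derivEval_monicJacobi_ne_zero hα hβ j).mono fun n hn =>
      mul_ne_zero (hscale n) hn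
  · simp only [mul_div_mul_left _ _ (hscale _)]
    exact tendsto_derivEval_div_derivEval_monicJacobi hα hβ hd hc hQ j

theorem proposition4p4 (α β M N : ℝ) (hα : -1 < α) (hβ : -1 < β) (hM : M ≠ 0) (hN : N ≠ 0) :
    (∀ᶠ n : ℕ in atTop, ∃! q : ℝ[X], IsMonicOrthogonal (sobolevForm α β (-1) M N) n q) ∧
    ∀ j : ℕ,
      (∀ᶠ n : ℕ in atTop, (derivative^[j] (scaledJacobi α β n)).eval (-1) ≠ 0) ∧
      Tendsto
        (fun n : ℕ => (derivative^[j] (scaledSobolevJacobi α β M N n)).eval (-1) /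
          (derivative^[j] (scaledJacobi α β n)).eval (-1))
        atTop
        (𝓝 ((j : ℝ) * ((j : ℝ) - 1) / ((β + (j : ℝ) + 1) * (β + (j : ℝ) + 2)))) := by
  have h := proposition4p4_general hα hβ Fin.val_injective (c := ![M, N])
    (Fin.forall_fin_two.2 ⟨hM, hN⟩)
  simp only [← sobolevForm_eq_jacobiFormWithMasses, ← scaledSobolevJacobi.eq_def] at h
  convert h using 7 with j
  rw [Fin.prod_univ_two, div_mul_div_comm]
  simp only [Fin.val_zero, Fin.val_one, Nat.cast_zero, Nat.cast_one, sub_zero, add_zero]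
  ring
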